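/- Fix a closed interval $I=[a,b]$ with $0<a<b<1$, a number $\sigma>0$ with $t^*=1/(1+\sigma^2)\notin I$, and a bound $\lambda_{\max}$. For integers $0\le k<d$ let $U\in\mathbb R^{d\times k}$ have orthonormal columns, let $\Lambda=\mathrm{diag}(\lambda_1,\dots,\lambda_k)$ with $0\le\lambda_i\le\lambda_{\max}$, and let $$\varepsilon\sim\mathcal N(0,I_d),\qquad x\sim\mathcal N(0,\,U\Lambda U^\top+\sigma^2 I_d),\qquad t\sim\mathrm{Unif}(I)$$ be mutually independent. Put $z=(1-t)\varepsilon+tx$ and $u=x-\varepsilon$. For a square-integrable random vector $X$ and a random variable $Y$ write $\mathrm{Var}(X\mid Y)=\mathbb E\bigl[\|X-\mathbb E[X\mid Y]\|^2\mid Y\bigr]$, and define the coupling variance and the time-blindness gap by $$\mathcal C_\pi=\mathbb E\bigl[\mathrm{Var}(u\mid z,t)\bigr],\qquad \Delta=\mathbb E\bigl[\mathrm{Var}\bigl(\mathbb E[u\mid z,t]\,\big|\,z\bigr)\bigr].$$ Then $\mathcal C_\pi>0$ and there is a constant $C$ depending only on $I$, $\sigma^2$ and $\lambda_{\max}$ (not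 on $d$, $k$, $U$ or the individual $\lambda_i$) such that $$\frac{\Delta}{\mathcal C_\pi}\le\frac{C}{d-k}\qquad\text{for all }0\le k<d.$$ In particular, for each fixed $k$ there is a constant $C'$, depending only on $k$, $I$, $\sigma^2$ and $\lambda_{\max}$, such that $\Delta/\mathcal C_\pi\le C'/d$ for all $d>k$. -/

import Mathlib

open MeasureTheory ProbabilityTheory

noncomputable section

namespace FlowMatching

variable {Ω : Type*} {m₀ : MeasurableSpace Ω} {d k : ℕ}

/-- Conditional variance of a random vector given a σ-algebra: the trace of the conditional
covariance, `Var(X | m) = E[‖X - E[X | m]‖² | m]`. -/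
def vecCondVar (P : Measure Ω) (m : MeasurableSpace Ω) (X : Ω → EuclideanSpace ℝ (Fin d)) :
    Ω → ℝ :=
  P[fun ω => ‖X ω - (P[X | m]) ω‖ ^ 2 | m]

/-- The linear interpolant `z = (1 - t) ε + t x`. -/
def interpolant (ε x : Ω → EuclideanSpace ℝ (Fin d)) (t : Ω → ℝ) :
    Ω → EuclideanSpace ℝ (Fin d) :=
  fun ω => (1 - t ω) • ε ω + t ω • x ω

/-- The conditional velocity `u = x - ε`. -/
def velocity (ε x : Ω → EuclideanSpace ℝ (Fin d)) : Ω → EuclideanSpace ℝ (Fin d) :=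
  fun ω => x ω - ε ω

/-- The σ-algebra generated by `z`. -/
abbrev sigmaZ (ε x : Ω → EuclideanSpace ℝ (Fin d)) (t : Ω → ℝ) : MeasurableSpace Ω :=
  MeasurableSpace.comap (interpolant ε x t) inferInstance

/-- The σ-algebra generated by the pair `(z, t)`. -/
abbrev sigmaZT (ε x : Ω → EuclideanSpace ℝ (Fin d)) (t : Ω → ℝ) : MeasurableSpace Ω :=
  MeasurableSpace.comap (fun ω => (interpolant ε x t ω, t ω)) inferInstance

/-- The coupling variance `C_π = E[Var(u | z, t)]`. -/
def couplingVariance (P : Measure Ω) (ε x : Ω → EuclideanSpace ℝ (Fin d)) (t : Ω → ℝ) : ℝ :=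
  ∫ ω, vecCondVar P (sigmaZT ε x t) (velocity ε x) ω ∂P

/-- The time-blindness gap `Δ = E[Var(E[u | z, t] | z)]`. -/
def timeBlindnessGap (P : Measure Ω) (ε x : Ω → EuclideanSpace ℝ (Fin d)) (t : Ω → ℝ) : ℝ :=
  ∫ ω, vecCondVar P (sigmaZ ε x t) (P[velocity ε x | sigmaZT ε x t]) ω ∂P

/-- The spiked covariance matrix `U Λ Uᵀ + σ² I`, with `Λ = diag(lam)`. -/
def spikedCovariance (σ : ℝ) (U : Matrix (Fin d) (Fin k) ℝ) (lam : Fin k → ℝ) :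
    Matrix (Fin d) (Fin d) ℝ :=
  U * Matrix.diagonal lam * U.transpose + σ ^ 2 • (1 : Matrix (Fin d) (Fin d) ℝ)

/-- The spiked Gaussian flow matching model with independent coupling, on the time interval
`[a, b]`: the columns of `U` are orthonormal, the excess variances lie in `[0, lamMax]`,
`ε ∼ N(0, I)`, `x ∼ N(0, U Λ Uᵀ + σ² I)` and `t ∼ Unif [a, b]`, all mutually independent. -/
structure IsSpikedModel (P : Measure Ω) (a b σ lamMax : ℝ)
    (U : Matrix (Fin d) (Fin k) ℝ) (lam : Fin k → ℝ)
    (ε x : Ω → EuclideanSpace ℝ (Fin d)) (t : Ω → ℝ) : Prop where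
  orthonormal : U.transpose * U = 1
  lam_nonneg : ∀ i, 0 ≤ lam i
  lam_le : ∀ i, lam i ≤ lamMax
  measurable_noise : Measurable ε
  measurable_data : Measurable x
  measurable_time : Measurable t
  noise_law : P.map ε = stdGaussian (EuclideanSpace ℝ (Fin d))
  data_law : P.map x = multivariateGaussian 0 (spikedCovariance σ U lam)
  time_law : pdf.IsUniform t (Set.Icc a b) P volume
  indep_coupling : IndepFun ε x P
  indep_time : IndepFun (fun ω => (ε ω, x ω)) t P

end FlowMatching

end

open MeasureTheory ProbabilityTheory

noncomputable section

namespace FlowMatching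

/-! ### Conditional expectation as an L² projection. -/

section CondVar

variable {Ω : Type*} {m m₀ : MeasurableSpace Ω} {d : ℕ}

/-! In an eigenbasis of the data covariance the model splits into independent Gaussian coordinates.
At a frozen time τ the best predictor of the velocity from `z` is linear and diagonal (`drift`),
with a residual independent of `z`. A direction of data variance s leaves residual variance s /
`interpVar s τ` ≥ σ²/(1+σ²), so the coupling variance is at least a constant times d
(`le_couplingVariance`).

The gap is small because `z` nearly reveals the time. The n = d - k isotropic coordinates share the
variance `interpVar (σ ^ 2) τ`, whose only critical point is t*. As t* lies outside the interval,
this curve has a Lipschitz inverse there (`exists_time_estimator`), and the empirical mean square R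
of these coordinates estimates it with squared error O(1/n) (`integral_sq_meanSq_sub_le`). By
optimality of conditional expectation (`integral_vecCondVar_le`), the gap is at most the cost of
using the estimated time in `drift`. Since `drift` is Lipschitz in time, that cost is of order (time
error)² ‖z‖², which `sq_estimator_mul_le` and the independence of the two blocks bound on average by
a constant times (n + k)/n = d/(d - k) (`timeBlindnessGap_le`). Dividing by the coupling variance
cancels d. -/

lemma eLpNorm_two_eq_integral {E : Type*} [NormedAddCommGroup E] {P : Measure Ω} {f : Ω → E}
    (hf : MemLp f 2 P) : (eLpNorm f 2 P).toReal ^ 2 = ∫ ω, ‖f ω‖ ^ 2 ∂P := by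
  rw [hf.eLpNorm_eq_integral_rpow_norm (by simp) (by simp), ENNReal.toReal_ofReal (by positivity),
    ← Real.rpow_natCast, ← Real.rpow_mul (by positivity)]
  simp

/-- The conditional expectation is the best mean-square predictor. -/
lemma integral_vecCondVar_le {P : Measure Ω} [IsProbabilityMeasure P]
    (hm : m ≤ m₀) {X h : Ω → EuclideanSpace ℝ (Fin d)} (hX : MemLp X 2 P) (hh : MemLp h 2 P)
    (hhm : AEStronglyMeasurable[m] h P) :
    ∫ ω, vecCondVar P m X ω ∂P ≤ ∫ ω, ‖X ω - h ω‖ ^ 2 ∂P := by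
  have : Fact (m ≤ m₀) := ⟨hm⟩
  have hE : MemLp (P[X | m]) 2 P := hX.condExp (by norm_num)
  unfold vecCondVar
  rw [integral_condExp hm]
  change ∫ ω, ‖(X - P[X | m]) ω‖ ^ 2 ∂P ≤ ∫ ω, ‖(X - h) ω‖ ^ 2 ∂P
  rw [← eLpNorm_two_eq_integral (hX.sub hE),
    ← eLpNorm_two_eq_integral (hX.sub hh)]
  refine pow_le_pow_left₀ ENNReal.toReal_nonneg ?_ 2
  -- The orthogonal projection onto the `m`-measurable subspace of L² minimises the distance to `X`;
  -- `h` is one competitor, and the projection agrees a.e. with the conditional expectation.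
  have key := (lpMeas (EuclideanSpace ℝ (Fin d)) ℝ m 2 P).starProjection_minimal (hX.toLp X)
  have hmem : hh.toLp h ∈ lpMeas (EuclideanSpace ℝ (Fin d)) ℝ m 2 P := by
    rw [mem_lpMeas_iff_aestronglyMeasurable]
    exact hhm.congr hh.coeFn_toLp.symm
  have hle : ‖hX.toLp X -
      (lpMeas (EuclideanSpace ℝ (Fin d)) ℝ m 2 P).starProjection (hX.toLp X)‖ ≤
      ‖hX.toLp X - hh.toLp h‖ := by
    rw [key]
    exact ciInf_le ⟨0, by rintro _ ⟨y, rfl⟩; exact norm_nonneg _⟩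
      (⟨_, hmem⟩ : lpMeas (EuclideanSpace ℝ (Fin d)) ℝ m 2 P)
  have hproj : (lpMeas (EuclideanSpace ℝ (Fin d)) ℝ m 2 P).starProjection (hX.toLp X) =
      hE.toLp _ := by
    refine Lp.ext ?_
    refine Filter.EventuallyEq.trans ?_ hE.coeFn_toLp.symm
    exact hX.condExpL2_ae_eq_condExp (𝕜 := ℝ) hm
  rw [hproj, ← MemLp.toLp_sub, ← MemLp.toLp_sub, Lp.norm_toLp, Lp.norm_toLp] at hle
  exact hle

end CondVar

/-! ### Scalar estimates for the variance and drift coefficients. -/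

section Coefficients

/-- The variance at time `τ` of the interpolant in a direction of data variance `s`. -/
def interpVar (s τ : ℝ) : ℝ := (1 - τ) ^ 2 + τ ^ 2 * s

/-- The regression coefficient at time `τ` of the velocity on the interpolant, in a direction of
data variance `s`. -/
def driftCoeff (s τ : ℝ) : ℝ := (τ * s - (1 - τ)) / interpVar s τ

lemma interpVar_pos {s : ℝ} (hs : 0 < s) (τ : ℝ) : 0 < interpVar s τ := by
  unfold interpVar
  by_cases h : τ = 0
  · simp [h]
  · positivity

@[fun_prop]
lemma measurable_interpVar (s : ℝ) : Measurable (interpVar s) := by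
  unfold interpVar; fun_prop

@[fun_prop]
lemma measurable_driftCoeff (s : ℝ) : Measurable (driftCoeff s) := by
  unfold driftCoeff; fun_prop

lemma interpVar_le {s S τ : ℝ} (hs : 0 ≤ s) (hS : s ≤ S) (h0 : 0 ≤ τ) (h1 : τ ≤ 1) :
    interpVar s τ ≤ 1 + S := by
  unfold interpVar
  have h2 : τ ^ 2 ≤ 1 := by nlinarith
  have h3 : (1 - τ) ^ 2 ≤ 1 := by nlinarith
  nlinarith [mul_le_mul_of_nonneg_right h2 hs]

lemma sq_le_interpVar {s b τ : ℝ} (hs : 0 ≤ s) (hτ : τ ≤ b) (hb : b < 1) :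
    (1 - b) ^ 2 ≤ interpVar s τ := by
  unfold interpVar
  nlinarith [mul_nonneg (sq_nonneg τ) hs]

/-- The cross-multiplied numerator is antisymmetric in the two times, hence divisible by τ - τ'. The
explicit cofactor reduces the Lipschitz estimate to bounding a polynomial. -/
lemma driftCoeff_sub {s τ τ' : ℝ} (hs : 0 < s) :
    driftCoeff s τ - driftCoeff s τ' =
      (τ - τ') * ((s + 1) * (1 + τ + τ') - (s + 1) ^ 2 * (τ * τ') - 2) /
        (interpVar s τ * interpVar s τ') := by
  have h1 := (interpVar_pos hs τ).ne'
  have h2 := (interpVar_pos hs τ').ne'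
  unfold driftCoeff
  rw [div_sub_div _ _ h1 h2]
  congr 1
  unfold interpVar
  ring

/-- Each denominator is at least (1 - b)², however small s is; the constant is therefore uniform
over all eigenvalues up to S. -/
lemma abs_driftCoeff_sub_le {s S b τ τ' : ℝ} (hs : 0 < s) (hS : s ≤ S) (hb : b < 1)
    (h0 : 0 ≤ τ) (hτ : τ ≤ b) (h0' : 0 ≤ τ') (hτ' : τ' ≤ b) :
    |driftCoeff s τ - driftCoeff s τ'| ≤
      (3 * (S + 1) + (S + 1) ^ 2 + 2) / (1 - b) ^ 4 * |τ - τ'| := by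
  have h1 := sq_le_interpVar hs.le hτ hb
  have h2 := sq_le_interpVar hs.le hτ' hb
  have hb' : 0 < 1 - b := by linarith
  have h3 : (1 - b) ^ 4 ≤ interpVar s τ * interpVar s τ' := by
    calc (1 - b) ^ 4 = (1 - b) ^ 2 * (1 - b) ^ 2 := by ring
      _ ≤ _ := mul_le_mul h1 h2 (by positivity) ((by positivity : (0:ℝ) ≤ (1-b)^2).trans h1)
  rw [driftCoeff_sub hs, abs_div, abs_mul, abs_of_pos (lt_of_lt_of_le (by positivity) h3),
    div_mul_eq_mul_div, mul_comm _ |τ - τ'|]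
  refine div_le_div₀ (by have : 0 < S := hs.trans_le hS; positivity) ?_ (by positivity) h3
  refine mul_le_mul_of_nonneg_left ?_ (abs_nonneg _)
  have e1 : 0 ≤ (s + 1) * (1 + τ + τ') := by positivity
  have e2 : 0 ≤ (s + 1) ^ 2 * (τ * τ') := by positivity
  have e3 : (s + 1) * (1 + τ + τ') ≤ (S + 1) * 3 :=
    mul_le_mul (by linarith) (by linarith) (by positivity) (by linarith)
  have e4 : (s + 1) ^ 2 * (τ * τ') ≤ (S + 1) ^ 2 * 1 :=
    mul_le_mul (pow_le_pow_left₀ (by linarith) (by linarith) 2) (by nlinarith)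
      (by positivity) (by positivity)
  rw [abs_le]
  constructor <;> nlinarith

lemma abs_driftCoeff_le {s S b τ : ℝ} (hs : 0 < s) (hS : s ≤ S) (hb : b < 1)
    (h0 : 0 ≤ τ) (hτ : τ ≤ b) : |driftCoeff s τ| ≤ (S + 1) / (1 - b) ^ 2 := by
  have h1 := sq_le_interpVar hs.le hτ hb
  have hb' : 0 < 1 - b := by linarith
  unfold driftCoeff
  rw [abs_div, abs_of_pos (interpVar_pos hs τ)]
  refine div_le_div₀ (by linarith) ?_ (by positivity) h1
  rw [abs_le]
  constructor <;> nlinarith [mul_nonneg h0 hs.le]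

/-- The variance curve of the isotropic directions can be inverted stably on an interval that
avoids its critical point. -/
lemma exists_time_estimator {a b σ : ℝ} (hab : a < b)
    (hI : 1 / (1 + σ ^ 2) ∉ Set.Icc a b) :
    ∃ (κ : ℝ) (T : ℝ → ℝ), 0 ≤ κ ∧ Measurable T ∧ (∀ r, T r ∈ Set.Icc a b) ∧
      ∀ τ ∈ Set.Icc a b, ∀ r, |T r - τ| ≤ κ * |r - interpVar (σ ^ 2) τ| := by
  have hq : 0 < 1 + σ ^ 2 := by positivity
  -- The quantity bounded below is the divided difference of the variance curve. It is the sum of (1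
  -- + σ²)τ - 1 at the two times; this affine function vanishes only at t*, so it has constant sign
  -- on the interval and is smallest in absolute value at the endpoint nearer t*.
  obtain ⟨c, hc, hcm⟩ : ∃ c : ℝ, 0 < c ∧ ∀ τ ∈ Set.Icc a b, ∀ τ' ∈ Set.Icc a b,
      c ≤ |(1 + σ ^ 2) * (τ + τ') - 2| := by
    rcases not_and_or.1 hI with h | h
    · rw [not_le, div_lt_iff₀ hq] at h
      refine ⟨2 * ((1 + σ ^ 2) * a - 1), by nlinarith, fun τ hτ τ' hτ' => ?_⟩
      refine le_trans ?_ (le_abs_self _)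
      nlinarith [mul_le_mul_of_nonneg_left (add_le_add hτ.1 hτ'.1) hq.le]
    · rw [not_le, lt_div_iff₀ hq] at h
      refine ⟨2 * (1 - (1 + σ ^ 2) * b), by nlinarith, fun τ hτ τ' hτ' => ?_⟩
      refine le_trans ?_ (neg_le_abs _)
      nlinarith [mul_le_mul_of_nonneg_left (add_le_add hτ.2 hτ'.2) hq.le]
  have hexp : ∀ τ ∈ Set.Icc a b, ∀ τ' ∈ Set.Icc a b,
      |τ - τ'| ≤ c⁻¹ * |interpVar (σ ^ 2) τ - interpVar (σ ^ 2) τ'| := by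
    intro τ hτ τ' hτ'
    have : interpVar (σ ^ 2) τ - interpVar (σ ^ 2) τ' =
        (τ - τ') * ((1 + σ ^ 2) * (τ + τ') - 2) := by unfold interpVar; ring
    rw [this, abs_mul, inv_mul_eq_div, le_div_iff₀ hc]
    exact mul_le_mul_of_nonneg_left (hcm τ hτ τ' hτ') (abs_nonneg _)
  have hinj : Set.InjOn (interpVar (σ ^ 2)) (Set.Icc a b) := by
    intro τ hτ τ' hτ' h
    have := hexp τ hτ τ' hτ'
    rw [h, sub_self, abs_zero, mul_zero] at this
    exact sub_eq_zero.1 (abs_nonpos_iff.1 this)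
  have hne : (Set.Icc a b).Nonempty := ⟨a, le_rfl, hab.le⟩
  have : Nonempty ℝ := ⟨0⟩
  let φ := Function.invFunOn (interpVar (σ ^ 2)) (Set.Icc a b)
  have hφ : ∀ τ ∈ Set.Icc a b, φ (interpVar (σ ^ 2) τ) = τ := fun τ hτ =>
    hinj.leftInvOn_invFunOn hτ
  have hL : LipschitzOnWith ⟨c⁻¹, by positivity⟩ φ (interpVar (σ ^ 2) '' Set.Icc a b) := by
    refine LipschitzOnWith.of_dist_le_mul ?_
    rintro _ ⟨τ, hτ, rfl⟩ _ ⟨τ', hτ', rfl⟩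
    rw [hφ τ hτ, hφ τ' hτ', Real.dist_eq, Real.dist_eq]
    exact hexp τ hτ τ' hτ'
  -- The inverse is controlled only on the image of the interval, while the empirical mean square
  -- can be any real; a Lipschitz extension covers all values and is measurable.
  obtain ⟨ψ, hψ, hψe⟩ := hL.extend_real
  -- Clamping to [a, b] is nonexpansive and fixes τ, so it preserves the error bound.
  refine ⟨c⁻¹, fun r => max a (min b (ψ r)), by positivity,
    measurable_const.max (measurable_const.min hψ.continuous.measurable),
    fun r => ⟨le_max_left _ _, max_le hab.le (min_le_left _ _)⟩, fun τ hτ r => ?_⟩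
  have h1 : |ψ r - τ| ≤ c⁻¹ * |r - interpVar (σ ^ 2) τ| := by
    have := hψ.dist_le_mul r (interpVar (σ ^ 2) τ)
    rwa [← hψe ⟨τ, hτ, rfl⟩, hφ τ hτ, Real.dist_eq, Real.dist_eq] at this
  refine le_trans ?_ h1
  calc |max a (min b (ψ r)) - τ| = |max a (min b (ψ r)) - max a (min b τ)| := by
        rw [min_eq_right hτ.2, max_eq_right hτ.1]
    _ ≤ |min b (ψ r) - min b τ| := by
        simpa using abs_max_sub_max_le_max a (min b (ψ r)) a (min b τ)
    _ ≤ |ψ r - τ| := by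
        simpa using abs_min_sub_min_le_max b (ψ r) b τ

end Coefficients

/-! ### Gaussian coordinates at a fixed time. -/

section Coordinates

variable {Ω : Type*} {m₀ : MeasurableSpace Ω} {ι α β : Type*}

/-- Jointly Gaussian centred families `e`, `x`, uncorrelated with each other, of unit variance and
of variances `s` respectively. -/
structure IsGaussianCoords [Finite ι] [DecidableEq ι] (P : Measure Ω) (e x : ι → Ω → ℝ)
    (s : ι → ℝ) : Prop where
  gauss : HasGaussianLaw (fun ω => ((fun i => e i ω, fun i => x i ω) : (ι → ℝ) × (ι → ℝ))) P
  mean_noise : ∀ i, ∫ ω, e i ω ∂P = 0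
  mean_data : ∀ i, ∫ ω, x i ω ∂P = 0
  cov_noise : ∀ i j, cov[e i, e j; P] = if i = j then 1 else 0
  cov_data : ∀ i j, cov[x i, x j; P] = if i = j then s i else 0
  cov_cross : ∀ i j, cov[e i, x j; P] = 0

/-- Coordinates of the interpolant. -/
def interpCoord (e x : ι → Ω → ℝ) (τ : ℝ) (i : ι) (ω : Ω) : ℝ := (1 - τ) * e i ω + τ * x i ω

/-- Coordinates of the residual of the regression of the velocity on the interpolant. -/
def residCoord (e x : ι → Ω → ℝ) (s : ι → ℝ) (τ : ℝ) (i : ι) (ω : Ω) : ℝ :=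
  x i ω - e i ω - driftCoeff (s i) τ * interpCoord e x τ i ω

/-- The mean square of the second block of coordinates. -/
def meanSq [Fintype β] (z : α ⊕ β → ℝ) : ℝ := (∑ j, z (Sum.inr j) ^ 2) / Fintype.card β

/-- The fourth moment of the standard Gaussian. -/
def gaussFourth : ℝ := ∫ y, y ^ 4 ∂(gaussianReal 0 1)

lemma gaussFourth_nonneg : 0 ≤ gaussFourth := integral_nonneg fun y => by positivity

lemma residCoord_eq_linear (e x : ι → Ω → ℝ) {s : ι → ℝ} {τ : ℝ} {i : ι} (hs : 0 < s i) (ω : Ω) :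
    residCoord e x s τ i ω =
      (-(τ * s i) / interpVar (s i) τ) * e i ω + ((1 - τ) / interpVar (s i) τ) * x i ω := by
  have h := (interpVar_pos hs τ).ne'
  unfold residCoord interpCoord driftCoeff
  field_simp
  unfold interpVar
  ring

lemma integral_pow_four_gaussianReal (v : NNReal) :
    ∫ y, y ^ 4 ∂(gaussianReal 0 v) = (v : ℝ) ^ 2 * gaussFourth := by
  have h : gaussianReal 0 v = (gaussianReal 0 1).map (fun y => √(v : ℝ) * y) := by
    rw [gaussianReal_map_const_mul]
    congr 1
    · simp
    · ext; simp
  rw [h, integral_map (by fun_prop) (by fun_prop), gaussFourth, ← integral_const_mul]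
  congr 1 with y
  rw [mul_pow, show √(v : ℝ) ^ 4 = (√(v : ℝ) ^ 2) ^ 2 by ring, Real.sq_sqrt v.coe_nonneg]

namespace IsGaussianCoords

section General

variable [Finite ι] [DecidableEq ι] {P : Measure Ω} {e x : ι → Ω → ℝ} {s : ι → ℝ}

lemma memLp_noise (h : IsGaussianCoords P e x s) (i : ι) {p : ENNReal} (hp : p ≠ ⊤) :
    MemLp (e i) p P := by
  have := Fintype.ofFinite ι
  exact (h.gauss.fst.eval i).memLp hp

lemma memLp_data (h : IsGaussianCoords P e x s) (i : ι) {p : ENNReal} (hp : p ≠ ⊤) :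
    MemLp (x i) p P := by
  have := Fintype.ofFinite ι
  exact (h.gauss.snd.eval i).memLp hp

lemma memLp_interp (h : IsGaussianCoords P e x s) (τ : ℝ) (i : ι) {p : ENNReal} (hp : p ≠ ⊤) :
    MemLp (interpCoord e x τ i) p P :=
  ((h.memLp_noise i hp).const_mul _).add ((h.memLp_data i hp).const_mul _)

/-- Interpolant and residual coordinates are both of this form, so all their second moments at a
fixed time come from here. -/
lemma cov_linear (h : IsGaussianCoords P e x s) (a b c d : ℝ) (i j : ι) :
    cov[fun ω => a * e i ω + b * x i ω, fun ω => c * e j ω + d * x j ω; P] =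
      if i = j then a * c + b * d * s i else 0 := by
  have := h.gauss.isProbabilityMeasure
  have h2 : (2 : ENNReal) ≠ ⊤ := by simp
  have A := (h.memLp_noise i h2).const_mul a
  have B := (h.memLp_data i h2).const_mul b
  have C := (h.memLp_noise j h2).const_mul c
  have D := (h.memLp_data j h2).const_mul d
  change cov[(fun ω => a * e i ω) + (fun ω => b * x i ω),
    (fun ω => c * e j ω) + (fun ω => d * x j ω); P] = _
  rw [covariance_add_left A B (C.add D), covariance_add_right A C D, covariance_add_right B C D]
  simp only [covariance_const_mul_left, covariance_const_mul_right]
  rw [h.cov_noise, h.cov_data, h.cov_cross, covariance_comm (x i), h.cov_cross]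
  split_ifs <;> ring

lemma integral_linear (h : IsGaussianCoords P e x s) (a b : ℝ) (i : ι) :
    ∫ ω, (a * e i ω + b * x i ω) ∂P = 0 := by
  have := h.gauss.isProbabilityMeasure
  have h1 : (1 : ENNReal) ≠ ⊤ := by simp
  rw [integral_add (((h.memLp_noise i h1).integrable le_rfl).const_mul _)
    (((h.memLp_data i h1).integrable le_rfl).const_mul _), integral_const_mul, integral_const_mul,
    h.mean_noise, h.mean_data]
  simp

lemma integral_sq_linear (h : IsGaussianCoords P e x s) (a b : ℝ) (i : ι) :
    ∫ ω, (a * e i ω + b * x i ω) ^ 2 ∂P = a ^ 2 + b ^ 2 * s i := by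
  have := h.gauss.isProbabilityMeasure
  have h2 : (2 : ENNReal) ≠ ⊤ := by simp
  have A := ((h.memLp_noise i h2).const_mul a).add ((h.memLp_data i h2).const_mul b)
  have hc := h.cov_linear a b a b i i
  have hsub := covariance_eq_sub A A
  have hz := h.integral_linear a b i
  change cov[fun ω => a * e i ω + b * x i ω, fun ω => a * e i ω + b * x i ω; P] =
    ∫ ω, (a * e i ω + b * x i ω) * (a * e i ω + b * x i ω) ∂P -
      (∫ ω, (a * e i ω + b * x i ω) ∂P) * ∫ ω, (a * e i ω + b * x i ω) ∂P at hsub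
  rw [hz, hc, if_pos rfl] at hsub
  simp only [pow_two]
  linarith

lemma integral_sq_interp (h : IsGaussianCoords P e x s) (τ : ℝ) (i : ι) :
    ∫ ω, interpCoord e x τ i ω ^ 2 ∂P = interpVar (s i) τ :=
  h.integral_sq_linear _ _ _

lemma integral_sq_resid (h : IsGaussianCoords P e x s) (τ : ℝ) {i : ι} (hs : 0 < s i) :
    ∫ ω, residCoord e x s τ i ω ^ 2 ∂P = s i / interpVar (s i) τ := by
  simp_rw [residCoord_eq_linear e x hs]
  rw [h.integral_sq_linear]
  have := (interpVar_pos hs τ).ne'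
  field_simp
  unfold interpVar
  ring

lemma integral_resid (h : IsGaussianCoords P e x s) (τ : ℝ) {i : ι} (hs : 0 < s i) :
    ∫ ω, residCoord e x s τ i ω ∂P = 0 := by
  simp_rw [residCoord_eq_linear e x hs]
  exact h.integral_linear _ _ _

lemma hasGaussianLaw_interp (h : IsGaussianCoords P e x s) (τ : ℝ) :
    HasGaussianLaw (fun ω i => interpCoord e x τ i ω) P := by
  have := Fintype.ofFinite ι
  exact h.gauss.map ((1 - τ) • ContinuousLinearMap.fst ℝ (ι → ℝ) (ι → ℝ) +
    τ • ContinuousLinearMap.snd ℝ (ι → ℝ) (ι → ℝ))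

/-- The regression coefficient makes the covariances vanish: the noise and data contributions ∓τ(1 -
τ)s / `interpVar s τ` cancel. Joint Gaussianity turns this into independence. -/
lemma indepFun_interp_resid (h : IsGaussianCoords P e x s) (hs : ∀ i, 0 < s i) (τ : ℝ) :
    IndepFun (fun ω i => interpCoord e x τ i ω) (fun ω i => residCoord e x s τ i ω) P := by
  have := Fintype.ofFinite ι
  refine HasGaussianLaw.indepFun_of_covariance_eval ?_ ?_
  · let L : (ι → ℝ) × (ι → ℝ) →L[ℝ] (ι → ℝ) := (1 - τ) • ContinuousLinearMap.fst ℝ (ι → ℝ) (ι → ℝ) +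
      τ • ContinuousLinearMap.snd ℝ (ι → ℝ) (ι → ℝ)
    let W : (ι → ℝ) × (ι → ℝ) →L[ℝ] (ι → ℝ) := ContinuousLinearMap.snd ℝ (ι → ℝ) (ι → ℝ) -
      ContinuousLinearMap.fst ℝ (ι → ℝ) (ι → ℝ) -
      ContinuousLinearMap.pi fun i => driftCoeff (s i) τ •
        ((ContinuousLinearMap.proj i : (ι → ℝ) →L[ℝ] ℝ).comp L)
    exact h.gauss.map (L.prod W)
  · intro i j
    have := h.cov_linear (1 - τ) τ (-(τ * s j) / interpVar (s j) τ) ((1 - τ) / interpVar (s j) τ) i j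
    have hj : residCoord e x s τ j = fun ω =>
        (-(τ * s j) / interpVar (s j) τ) * e j ω + ((1 - τ) / interpVar (s j) τ) * x j ω :=
      funext fun ω => residCoord_eq_linear e x (hs j) ω
    rw [hj]
    refine this.trans ?_
    split_ifs with hij
    · subst hij; ring
    · rfl

lemma iIndepFun_interp (h : IsGaussianCoords P e x s) (τ : ℝ) :
    iIndepFun (interpCoord e x τ) P :=
  (h.hasGaussianLaw_interp τ).iIndepFun_of_covariance_eq_zero fun i j hij =>
    (h.cov_linear (1 - τ) τ (1 - τ) τ i j).trans (if_neg hij)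

lemma integral_pow_four_interp (h : IsGaussianCoords P e x s) (hs : ∀ i, 0 < s i) (τ : ℝ) (i : ι) :
    ∫ ω, interpCoord e x τ i ω ^ 4 ∂P = interpVar (s i) τ ^ 2 * gaussFourth := by
  have := Fintype.ofFinite ι
  have := h.gauss.isProbabilityMeasure
  have hg := (h.hasGaussianLaw_interp τ).eval i
  have hmap := hg.map_eq_gaussianReal
  have hm : ∫ ω, interpCoord e x τ i ω ∂P = 0 := h.integral_linear _ _ _
  have hv : Var[interpCoord e x τ i; P] = interpVar (s i) τ := by
    rw [← covariance_self hg.aemeasurable]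
    refine (h.cov_linear (1 - τ) τ (1 - τ) τ i i).trans ?_
    rw [if_pos rfl]
    unfold interpVar
    ring
  rw [hm, hv] at hmap
  rw [← integral_map (f := fun y : ℝ => y ^ 4) hg.aemeasurable (by fun_prop), hmap,
    integral_pow_four_gaussianReal, Real.coe_toNNReal _ (interpVar_pos (hs i) τ).le]

lemma memLp_interp_sq (h : IsGaussianCoords P e x s) (τ : ℝ) (i : ι) :
    MemLp (fun ω => interpCoord e x τ i ω ^ 2) 2 P := by
  have h4 := h.memLp_interp τ i (p := 4) (by simp)
  refine (memLp_two_iff_integrable_sq (h4.1.pow 2)).2 ?_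
  have := h4.integrable_norm_pow (p := 4) (by norm_num)
  refine this.congr (Filter.Eventually.of_forall fun ω => ?_)
  simp only [Pi.pow_apply, Real.norm_eq_abs]
  rw [← abs_pow, abs_of_nonneg (by positivity)]
  ring

/-- The variance is bounded crudely by the second moment; only its order matters. -/
lemma variance_interp_sq_le (h : IsGaussianCoords P e x s) (hs : ∀ i, 0 < s i) (τ : ℝ) (i : ι) :
    Var[fun ω => interpCoord e x τ i ω ^ 2; P] ≤ interpVar (s i) τ ^ 2 * gaussFourth := by
  have := h.gauss.isProbabilityMeasure
  rw [← h.integral_pow_four_interp hs]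
  refine (variance_le_expectation_sq (h.memLp_interp_sq τ i).1).trans (le_of_eq ?_)
  congr 1 with ω
  simp only [Pi.pow_apply]
  ring

end General

section Blocks

variable [Fintype α] [Fintype β] [DecidableEq α] [DecidableEq β] {P : Measure Ω}
  {e x : α ⊕ β → Ω → ℝ} {s : α ⊕ β → ℝ}

lemma indepFun_blocks (h : IsGaussianCoords P e x s) (τ : ℝ) :
    IndepFun (fun ω i => interpCoord e x τ (Sum.inl i) ω)
      (fun ω j => interpCoord e x τ (Sum.inr j) ω) P := by
  refine HasGaussianLaw.indepFun_of_covariance_eval ?_ ?_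
  · let A : (α ⊕ β → ℝ) →L[ℝ] (α → ℝ) :=
      ContinuousLinearMap.pi fun i => ContinuousLinearMap.proj (Sum.inl i)
    let B : (α ⊕ β → ℝ) →L[ℝ] (β → ℝ) :=
      ContinuousLinearMap.pi fun j => ContinuousLinearMap.proj (Sum.inr j)
    exact (h.hasGaussianLaw_interp τ).map (A.prod B)
  · intro i j
    exact (h.cov_linear (1 - τ) τ (1 - τ) τ (Sum.inl i) (Sum.inr j)).trans (if_neg (by simp))

lemma memLp_meanSq (h : IsGaussianCoords P e x s) (τ : ℝ) :
    MemLp (fun ω => meanSq fun i => interpCoord e x τ i ω) 2 P := by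
  unfold meanSq
  simp only [div_eq_mul_inv]
  exact (memLp_finsetSum _ fun j _ => h.memLp_interp_sq τ (Sum.inr j)).mul_const _

/-- The mean square is an unbiased average of independent terms, so its mean-square error is its
variance, which carries the factor 1/`Fintype.card β`. -/
lemma integral_sq_meanSq_sub_le [Nonempty β] (h : IsGaussianCoords P e x s) (hs : ∀ i, 0 < s i)
    {v : ℝ} (hv : ∀ j, s (Sum.inr j) = v) (τ : ℝ) :
    ∫ ω, (meanSq (fun i => interpCoord e x τ i ω) - interpVar v τ) ^ 2 ∂P ≤
      interpVar v τ ^ 2 * gaussFourth / Fintype.card β := by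
  have := h.gauss.isProbabilityMeasure
  have hn : (0 : ℝ) < Fintype.card β := by exact_mod_cast Fintype.card_pos
  have hmean : ∫ ω, meanSq (fun i => interpCoord e x τ i ω) ∂P = interpVar v τ := by
    unfold meanSq
    rw [integral_div, integral_finsetSum _ fun j _ =>
      (h.memLp_interp_sq τ (Sum.inr j)).integrable (by norm_num)]
    simp only [h.integral_sq_interp, hv]
    simp
  have hvar : Var[fun ω => meanSq (fun i => interpCoord e x τ i ω); P] =
      ∫ ω, (meanSq (fun i => interpCoord e x τ i ω) - interpVar v τ) ^ 2 ∂P := by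
    rw [variance_eq_integral (h.memLp_meanSq τ).1.aemeasurable, hmean]
  rw [← hvar]
  have hsum : Var[∑ j : β, fun ω => interpCoord e x τ (Sum.inr j) ω ^ 2; P] =
      ∑ j : β, Var[fun ω => interpCoord e x τ (Sum.inr j) ω ^ 2; P] := by
    refine IndepFun.variance_sum (fun j _ => h.memLp_interp_sq τ _) fun j _ j' _ hjj' => ?_
    exact ((h.iIndepFun_interp τ).indepFun (i := Sum.inr j) (j := Sum.inr j') (by simpa using hjj')).comp
      (φ := fun y : ℝ => y ^ 2) (ψ := fun y : ℝ => y ^ 2) (by fun_prop) (by fun_prop)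
  have heq : (fun ω => meanSq (fun i => interpCoord e x τ i ω)) =
      fun ω => (Fintype.card β : ℝ)⁻¹ *
        (∑ j : β, fun ω => interpCoord e x τ (Sum.inr j) ω ^ 2) ω := by
    funext ω
    simp [meanSq, div_eq_inv_mul]
  rw [heq, variance_const_mul, hsum]
  calc (Fintype.card β : ℝ)⁻¹ ^ 2 * ∑ j : β, Var[fun ω => interpCoord e x τ (Sum.inr j) ω ^ 2; P]
      ≤ (Fintype.card β : ℝ)⁻¹ ^ 2 * ∑ _j : β, interpVar v τ ^ 2 * gaussFourth := by
        gcongr with j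
        simpa [hv j] using h.variance_interp_sq_le hs τ (Sum.inr j)
    _ = _ := by
        simp
        field_simp

/-- The weight involves only the first block and the deviation only the second; by independence the
expectation factors. -/
lemma lintegral_meanSq_dev_le [Nonempty β] (h : IsGaussianCoords P e x s) (hs : ∀ i, 0 < s i)
    {v : ℝ} (hv : ∀ j, s (Sum.inr j) = v) (τ : ℝ) {A B V : ℝ} (hA : 0 ≤ A) (hB : 0 ≤ B)
    (hV : ∀ i, interpVar (s i) τ ≤ V) :
    ∫⁻ ω, ENNReal.ofReal ((meanSq (fun i => interpCoord e x τ i ω) - interpVar v τ) ^ 2 *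
        (A + B * ∑ i : α, interpCoord e x τ (Sum.inl i) ω ^ 2)) ∂P ≤
      ENNReal.ofReal (V ^ 2 * gaussFourth / Fintype.card β * (A + B * (Fintype.card α * V))) := by
  have := h.gauss.isProbabilityMeasure
  have hn : (0 : ℝ) < Fintype.card β := by exact_mod_cast Fintype.card_pos
  have hind : IndepFun (fun ω => (meanSq (fun i => interpCoord e x τ i ω) - interpVar v τ) ^ 2)
      (fun ω => A + B * ∑ i : α, interpCoord e x τ (Sum.inl i) ω ^ 2) P :=
    (h.indepFun_blocks τ).symm.comp
      (φ := fun z : β → ℝ => ((∑ j, z j ^ 2) / Fintype.card β - interpVar v τ) ^ 2)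
      (ψ := fun z : α → ℝ => A + B * ∑ i, z i ^ 2) (by fun_prop) (by fun_prop)
  have hint1 : Integrable
      (fun ω => (meanSq (fun i => interpCoord e x τ i ω) - interpVar v τ) ^ 2) P :=
    ((h.memLp_meanSq τ).sub (memLp_const _)).integrable_sq
  have hsq : ∀ i : α, Integrable (fun ω => interpCoord e x τ (Sum.inl i) ω ^ 2) P :=
    fun i => (h.memLp_interp_sq τ (Sum.inl i)).integrable (by norm_num)
  have hint2 : Integrable (fun ω => A + B * ∑ i : α, interpCoord e x τ (Sum.inl i) ω ^ 2) P :=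
    (integrable_const _).add ((integrable_finsetSum _ fun i _ => hsq i).const_mul _)
  have hprod := hind.integrable_mul hint1 hint2
  have hval := hind.integral_mul_eq_mul_integral hint1.1 hint2.1
  simp only [Pi.mul_def] at hprod hval
  rw [← ofReal_integral_eq_lintegral_ofReal hprod (Filter.Eventually.of_forall fun ω => by
    dsimp only; positivity), hval]
  refine ENNReal.ofReal_le_ofReal (mul_le_mul ?_ ?_ ?_ ?_)
  · refine (h.integral_sq_meanSq_sub_le hs hv τ).trans ?_
    obtain ⟨j⟩ := ‹Nonempty β›
    have h1 := hV (Sum.inr j)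
    rw [hv j] at h1
    have h2 : 0 < v := hv j ▸ hs (Sum.inr j)
    have h3 := (interpVar_pos h2 τ).le
    have := gaussFourth_nonneg
    gcongr
  · rw [integral_add (integrable_const _)
      ((integrable_finsetSum _ fun i _ => hsq i).const_mul _), integral_const_mul,
      integral_finsetSum _ fun i _ => hsq i]
    simp only [h.integral_sq_interp]
    have : ∑ i : α, interpVar (s (Sum.inl i)) τ ≤ Fintype.card α * V := by
      refine (Finset.sum_le_sum fun i _ => hV (Sum.inl i)).trans ?_
      simp
    simp
    gcongr
  · exact integral_nonneg fun ω => by positivity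
  · have := gaussFourth_nonneg
    positivity

end Blocks

end IsGaussianCoords

end Coordinates

/-! ### Diagonalising the spiked model. -/

section Model

open scoped InnerProductSpace Matrix

variable {Ω : Type*} {m₀ : MeasurableSpace Ω} {d k : ℕ}

/-- Eigenvalues of the spiked covariance matrix, the spikes first. -/
def spikedEigenvalue (σ : ℝ) (lam : Fin k → ℝ) (n : ℕ) : Fin k ⊕ Fin n → ℝ :=
  Sum.elim (fun i => σ ^ 2 + lam i) (fun _ => σ ^ 2)

/-- An orthonormal family of columns extends to an orthonormal basis. -/
lemma exists_orthonormalBasis_columns {U : Matrix (Fin d) (Fin k) ℝ} (hU : U.transpose * U = 1)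
    (hkd : k < d) :
    ∃ b : OrthonormalBasis (Fin k ⊕ Fin (d - k)) ℝ (EuclideanSpace ℝ (Fin d)),
      ∀ i, b (Sum.inl i) = WithLp.toLp 2 (U.col i) := by
  let v : Fin k ⊕ Fin (d - k) → EuclideanSpace ℝ (Fin d) :=
    Sum.elim (fun i => WithLp.toLp 2 (U.col i)) 0
  have hin : ∀ i j : Fin k, ⟪(WithLp.toLp 2 (U.col i) : EuclideanSpace ℝ (Fin d)),
      WithLp.toLp 2 (U.col j)⟫_ℝ = if i = j then 1 else 0 := by
    intro i j
    have := congrFun (congrFun hU i) j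
    rw [Matrix.mul_apply, Matrix.one_apply] at this
    rw [← this, PiLp.inner_apply]
    exact Finset.sum_congr rfl fun l _ => by simp [mul_comm]
  have hv : Orthonormal ℝ ((Set.range (Sum.inl : Fin k → Fin k ⊕ Fin (d - k))).domRestrict v) := by
    rw [orthonormal_iff_ite]
    rintro ⟨_, i, rfl⟩ ⟨_, j, rfl⟩
    by_cases hij : i = j
    · subst hij
      simpa [v] using hin i i
    · rw [if_neg fun h => hij (Sum.inl_injective (congrArg Subtype.val h))]
      simpa [v, hij] using hin i j
  obtain ⟨b, hb⟩ := hv.exists_orthonormalBasis_extension_of_card_eq (by simp; omega)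
  exact ⟨b, fun i => hb _ ⟨i, rfl⟩⟩

lemma posSemidef_spikedCovariance (σ : ℝ) (U : Matrix (Fin d) (Fin k) ℝ) {lam : Fin k → ℝ}
    (hlam : ∀ i, 0 ≤ lam i) : (spikedCovariance σ U lam).PosSemidef := by
  unfold spikedCovariance
  refine Matrix.PosSemidef.add ?_ (Matrix.PosSemidef.one.smul (sq_nonneg σ))
  simpa using (Matrix.PosSemidef.diagonal hlam).mul_mul_conjTranspose_same U

/-- `U.transpose` maps the first block of the basis to the standard basis and kills the second, so
the basis diagonalises the covariance. -/
lemma spikedCovariance_apply_basis {σ : ℝ} {U : Matrix (Fin d) (Fin k) ℝ} {lam : Fin k → ℝ} {n : ℕ}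
    {b : OrthonormalBasis (Fin k ⊕ Fin n) ℝ (EuclideanSpace ℝ (Fin d))}
    (hb : ∀ i, b (Sum.inl i) = WithLp.toLp 2 (U.col i)) (i j : Fin k ⊕ Fin n) :
    (b i).ofLp ⬝ᵥ spikedCovariance σ U lam *ᵥ (b j).ofLp =
      if i = j then spikedEigenvalue σ lam n i else 0 := by
  have hdot : ∀ i j, (b i).ofLp ⬝ᵥ (b j).ofLp = if i = j then 1 else 0 := by
    intro i j
    have := orthonormal_iff_ite.1 b.orthonormal i j
    rw [← this, PiLp.inner_apply]
    exact Finset.sum_congr rfl fun l _ => by simp [mul_comm]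
  have hcol : ∀ i l, (U.transpose *ᵥ (b i).ofLp) l = if Sum.inl l = i then 1 else 0 := by
    intro i l
    rw [← hdot, hb]
    rfl
  rw [spikedCovariance, Matrix.add_mulVec, dotProduct_add, ← Matrix.mulVec_mulVec,
    ← Matrix.mulVec_mulVec, Matrix.dotProduct_mulVec, ← Matrix.mulVec_transpose,
    Matrix.smul_mulVec, Matrix.one_mulVec, dotProduct_smul, hdot]
  simp only [dotProduct, Matrix.mulVec_diagonal, hcol]
  rcases i with i | i <;> rcases j with j | j <;>
    simp [spikedEigenvalue, eq_comm, add_comm]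
  by_cases hij : i = j <;> simp [hij]

lemma covariance_inner_eq {P : Measure Ω} [IsProbabilityMeasure P]
    {X : Ω → EuclideanSpace ℝ (Fin d)} (hX : Measurable X) [IsGaussian (P.map X)]
    (y z : EuclideanSpace ℝ (Fin d)) :
    cov[fun ω => ⟪y, X ω⟫_ℝ, fun ω => ⟪z, X ω⟫_ℝ; P] = covarianceBilin (P.map X) y z := by
  rw [covarianceBilin_apply_eq_cov IsGaussian.memLp_two_id, covariance_map_fun (by fun_prop)
    (by fun_prop) hX.aemeasurable]

lemma integral_inner_eq {P : Measure Ω} [IsProbabilityMeasure P]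
    {X : Ω → EuclideanSpace ℝ (Fin d)} (hX : Measurable X) [IsGaussian (P.map X)]
    (hz : ∫ y, y ∂(P.map X) = 0) (y : EuclideanSpace ℝ (Fin d)) :
    ∫ ω, ⟪y, X ω⟫_ℝ ∂P = 0 := by
  have hint : Integrable X P := by
    have : Integrable id (P.map X) := IsGaussian.integrable_id
    exact (integrable_map_measure aestronglyMeasurable_id hX.aemeasurable).1 this
  rw [integral_inner hint, ← integral_map (f := fun y => y) hX.aemeasurable (by fun_prop), hz,
    inner_zero_right]

/-- In an eigenbasis the model splits into independent Gaussian coordinates. -/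
lemma IsSpikedModel.isGaussianCoords {P : Measure Ω} [IsProbabilityMeasure P]
    {a b σ lamMax : ℝ} {U : Matrix (Fin d) (Fin k) ℝ} {lam : Fin k → ℝ}
    {ε x : Ω → EuclideanSpace ℝ (Fin d)} {t : Ω → ℝ}
    (h : IsSpikedModel P a b σ lamMax U lam ε x t) {n : ℕ}
    {B : OrthonormalBasis (Fin k ⊕ Fin n) ℝ (EuclideanSpace ℝ (Fin d))}
    (hB : ∀ i, B (Sum.inl i) = WithLp.toLp 2 (U.col i)) :
    IsGaussianCoords P (fun i ω => ⟪B i, ε ω⟫_ℝ) (fun i ω => ⟪B i, x ω⟫_ℝ)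
      (spikedEigenvalue σ lam n) := by
  have gε : IsGaussian (P.map ε) := by rw [h.noise_law]; infer_instance
  have gx : IsGaussian (P.map x) := by rw [h.data_law]; infer_instance
  have hε := h.measurable_noise
  have hx := h.measurable_data
  have gauss : HasGaussianLaw (fun ω => (ε ω, x ω)) P :=
    h.indep_coupling.hasGaussianLaw ⟨gε⟩ ⟨gx⟩
  refine ⟨?_, fun i => ?_, fun i => ?_, fun i j => ?_, fun i j => ?_, fun i j => ?_⟩
  · let C : EuclideanSpace ℝ (Fin d) →L[ℝ] (Fin k ⊕ Fin n → ℝ) :=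
      ContinuousLinearMap.pi fun i => innerSL ℝ (B i)
    exact gauss.map (C.prodMap C)
  · exact integral_inner_eq hε (by rw [h.noise_law]; simp) _
  · exact integral_inner_eq hx (by rw [h.data_law]; simp) _
  · rw [covariance_inner_eq hε, h.noise_law, covarianceBilin_stdGaussian]
    exact orthonormal_iff_ite.1 B.orthonormal i j
  · rw [covariance_inner_eq hx, h.data_law,
      covarianceBilin_multivariateGaussian (posSemidef_spikedCovariance σ U h.lam_nonneg)]
    exact spikedCovariance_apply_basis hB i j
  · refine IndepFun.covariance_eq_zero ?_ ?_ ?_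
    · exact h.indep_coupling.comp (φ := fun y => ⟪B i, y⟫_ℝ) (ψ := fun y => ⟪B j, y⟫_ℝ)
        (by fun_prop) (by fun_prop)
    · exact (HasGaussianLaw.map (X := ε) ⟨gε⟩ (innerSL ℝ (B i))).memLp (by simp)
    · exact (HasGaussianLaw.map (X := x) ⟨gx⟩ (innerSL ℝ (B j))).memLp (by simp)

end Model

/-! ### Freezing the independent time variable. -/

section Fubini

variable {Ω α β : Type*} {m₀ : MeasurableSpace Ω} [MeasurableSpace α] [MeasurableSpace β]
  {P : Measure Ω} [IsProbabilityMeasure P] {X : Ω → α} {T : Ω → β}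

lemma lintegral_indep (hX : Measurable X) (hT : Measurable T) (h : IndepFun X T P)
    {F : α × β → ENNReal} (hF : Measurable F) :
    ∫⁻ ω, F (X ω, T ω) ∂P = ∫⁻ y, ∫⁻ ω, F (X ω, y) ∂P ∂(P.map T) := by
  have := Measure.isProbabilityMeasure_map hX.aemeasurable (μ := P)
  have := Measure.isProbabilityMeasure_map hT.aemeasurable (μ := P)
  have hmap := (indepFun_iff_map_prod_eq_prod_map_map hX.aemeasurable hT.aemeasurable).1 h
  rw [← lintegral_map (f := F) hF (hX.prodMk hT), hmap, lintegral_prod_symm' _ hF]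
  refine lintegral_congr fun y => ?_
  exact lintegral_map (hF.comp (measurable_id.prodMk measurable_const)) hX

lemma integral_indep (hX : Measurable X) (hT : Measurable T) (h : IndepFun X T P)
    {F : α × β → ℝ} (hF : Measurable F) (hint : Integrable (fun ω => F (X ω, T ω)) P) :
    ∫ ω, F (X ω, T ω) ∂P = ∫ y, ∫ ω, F (X ω, y) ∂P ∂(P.map T) := by
  have := Measure.isProbabilityMeasure_map hX.aemeasurable (μ := P)
  have := Measure.isProbabilityMeasure_map hT.aemeasurable (μ := P)
  have hmap := (indepFun_iff_map_prod_eq_prod_map_map hX.aemeasurable hT.aemeasurable).1 h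
  have hint' := (integrable_map_measure (f := fun ω => (X ω, T ω)) (g := F) (μ := P)
    hF.aestronglyMeasurable (hX.prodMk hT).aemeasurable).2 hint
  rw [hmap] at hint'
  rw [← integral_map (f := F) (hX.prodMk hT).aemeasurable hF.aestronglyMeasurable, hmap,
    integral_prod_symm _ hint']
  refine integral_congr_ae (Filter.Eventually.of_forall fun y => ?_)
  exact integral_map hX.aemeasurable (hF.comp (by fun_prop)).aestronglyMeasurable

end Fubini

/-! ### The predictor as a vector field, and the pointwise error estimate. -/

section Field

open scoped InnerProductSpace

variable {d : ℕ} {ι : Type*} [Fintype ι]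

lemma norm_sq_sum_smul_basis (B : OrthonormalBasis ι ℝ (EuclideanSpace ℝ (Fin d))) (c : ι → ℝ) :
    ‖∑ i, c i • B i‖ ^ 2 = ∑ i, c i ^ 2 := by
  classical
  rw [← B.sum_sq_inner_right]
  refine Finset.sum_congr rfl fun i _ => ?_
  rw [inner_sum]
  simp [inner_smul_right, B.inner_eq_ite]

/-- The minimum mean-square predictor of the velocity from the interpolant and the time. -/
def drift (B : OrthonormalBasis ι ℝ (EuclideanSpace ℝ (Fin d))) (s : ι → ℝ)
    (z : EuclideanSpace ℝ (Fin d)) (τ : ℝ) : EuclideanSpace ℝ (Fin d) :=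
  ∑ i, (driftCoeff (s i) τ * ⟪B i, z⟫_ℝ) • B i

/-- The coordinates of the noise in the basis `B`. -/
def noiseCoord (B : OrthonormalBasis ι ℝ (EuclideanSpace ℝ (Fin d))) (i : ι)
    (p : EuclideanSpace ℝ (Fin d) × EuclideanSpace ℝ (Fin d)) : ℝ := ⟪B i, p.1⟫_ℝ

/-- The coordinates of the data in the basis `B`. -/
def dataCoord (B : OrthonormalBasis ι ℝ (EuclideanSpace ℝ (Fin d))) (i : ι)
    (p : EuclideanSpace ℝ (Fin d) × EuclideanSpace ℝ (Fin d)) : ℝ := ⟪B i, p.2⟫_ℝ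

variable (B : OrthonormalBasis ι ℝ (EuclideanSpace ℝ (Fin d))) (s : ι → ℝ)

lemma measurable_drift :
    Measurable fun q : EuclideanSpace ℝ (Fin d) × ℝ => drift B s q.1 q.2 := by
  unfold drift
  exact Finset.measurable_sum _ fun i _ => by
    have h1 : Measurable fun q : EuclideanSpace ℝ (Fin d) × ℝ => driftCoeff (s i) q.2 :=
      (measurable_driftCoeff (s i)).comp measurable_snd
    have h2 : Measurable fun q : EuclideanSpace ℝ (Fin d) × ℝ => ⟪B i, q.1⟫_ℝ := by fun_prop
    exact (h1.mul h2).smul_const _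

lemma inner_interp (p : EuclideanSpace ℝ (Fin d) × EuclideanSpace ℝ (Fin d)) (τ : ℝ) (i : ι) :
    ⟪B i, (1 - τ) • p.1 + τ • p.2⟫_ℝ = interpCoord (noiseCoord B) (dataCoord B) τ i p := by
  simp [interpCoord, noiseCoord, dataCoord, inner_add_right, inner_smul_right]

lemma velocity_sub_drift (p : EuclideanSpace ℝ (Fin d) × EuclideanSpace ℝ (Fin d)) (τ : ℝ) :
    p.2 - p.1 - drift B s ((1 - τ) • p.1 + τ • p.2) τ =
      ∑ i, residCoord (noiseCoord B) (dataCoord B) s τ i p • B i := by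
  conv_lhs => rw [← B.sum_repr' (p.2 - p.1)]
  rw [drift, ← Finset.sum_sub_distrib]
  refine Finset.sum_congr rfl fun i _ => ?_
  rw [inner_interp, ← sub_smul, inner_sub_right]
  rfl

lemma norm_drift_le {G : ℝ} {τ : ℝ} (hG : ∀ i, |driftCoeff (s i) τ| ≤ G) (hG0 : 0 ≤ G)
    (z : EuclideanSpace ℝ (Fin d)) : ‖drift B s z τ‖ ≤ G * ‖z‖ := by
  refine (sq_le_sq₀ (norm_nonneg _) (by positivity)).1 ?_
  rw [drift, norm_sq_sum_smul_basis, mul_pow, ← B.sum_sq_inner_right, Finset.mul_sum]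
  refine Finset.sum_le_sum fun i _ => ?_
  rw [mul_pow]
  exact mul_le_mul_of_nonneg_right (sq_le_sq' (abs_le.1 (hG i)).1 (abs_le.1 (hG i)).2)
    (sq_nonneg _)

lemma norm_drift_sub_sq_le {L : ℝ} {τ τ' : ℝ}
    (hL : ∀ i, |driftCoeff (s i) τ - driftCoeff (s i) τ'| ≤ L * |τ - τ'|)
    (z : EuclideanSpace ℝ (Fin d)) :
    ‖drift B s z τ - drift B s z τ'‖ ^ 2 ≤ L ^ 2 * (τ - τ') ^ 2 * ∑ i, ⟪B i, z⟫_ℝ ^ 2 := by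
  have : drift B s z τ - drift B s z τ' =
      ∑ i, ((driftCoeff (s i) τ - driftCoeff (s i) τ') * ⟪B i, z⟫_ℝ) • B i := by
    rw [drift, drift, ← Finset.sum_sub_distrib]
    exact Finset.sum_congr rfl fun i _ => by rw [← sub_smul, sub_mul]
  rw [this, norm_sq_sum_smul_basis, Finset.mul_sum]
  refine Finset.sum_le_sum fun i _ => ?_
  rw [mul_pow]
  gcongr
  rw [← sq_abs (τ - τ'), ← mul_pow, ← sq_abs (driftCoeff _ _ - _)]
  exact pow_le_pow_left₀ (abs_nonneg _) (hL i) 2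

/-- Here δ is the time error and Q + nR is ‖z‖², with Q the spike energy. Writing R = v + (R - v),
the last term would give a cube of R - v; using |δ| ≤ 1 on one factor of δ keeps it quadratic, so
fourth Gaussian moments suffice. -/
lemma sq_estimator_mul_le {δ R v κ V n Q : ℝ} (hδ : |δ| ≤ κ * |R - v|) (hδ1 : |δ| ≤ 1)
    (hvV : v ≤ V) (hV : 0 ≤ V) (hn : 0 ≤ n) (hQ : 0 ≤ Q) :
    δ ^ 2 * (Q + n * R) ≤ (R - v) ^ 2 * (n * (κ ^ 2 * V + κ) + κ ^ 2 * Q) := by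
  have h0 := abs_nonneg δ
  have h1 : δ ^ 2 ≤ κ ^ 2 * (R - v) ^ 2 := by
    rw [← sq_abs δ, ← sq_abs (R - v), ← mul_pow]
    exact pow_le_pow_left₀ h0 hδ 2
  have h2 : δ ^ 2 * (R - v) ≤ κ * (R - v) ^ 2 := by
    calc δ ^ 2 * (R - v) ≤ δ ^ 2 * |R - v| :=
          mul_le_mul_of_nonneg_left (le_abs_self _) (sq_nonneg _)
      _ ≤ |δ| * |R - v| := by
          refine mul_le_mul_of_nonneg_right ?_ (abs_nonneg _)
          rw [← sq_abs]; nlinarith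
      _ ≤ κ * |R - v| * |R - v| := mul_le_mul_of_nonneg_right hδ (abs_nonneg _)
      _ = κ * (R - v) ^ 2 := by rw [mul_assoc, abs_mul_abs_self, pow_two]
  have h3 : δ ^ 2 * v ≤ κ ^ 2 * (R - v) ^ 2 * V :=
    (mul_le_mul_of_nonneg_left hvV (sq_nonneg _)).trans (mul_le_mul_of_nonneg_right h1 hV)
  have h4 : δ ^ 2 * R ≤ (R - v) ^ 2 * (κ ^ 2 * V + κ) := by linarith
  have h5 := mul_le_mul_of_nonneg_left h4 hn
  have h6 := mul_le_mul_of_nonneg_right h1 hQ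
  linarith

end Field

/-! ### Bounds on the coupling variance and the gap. -/

section Model

open scoped InnerProductSpace

variable {Ω : Type*} {m₀ : MeasurableSpace Ω} {d k n : ℕ}

lemma sq_le_spikedEigenvalue (σ : ℝ) {lam : Fin k → ℝ} (hlam : ∀ i, 0 ≤ lam i)
    (i : Fin k ⊕ Fin n) : σ ^ 2 ≤ spikedEigenvalue σ lam n i := by
  rcases i with i | i <;> simp [spikedEigenvalue, hlam]

/-- The maximum with 0 serves the isotropic directions: when k = 0 nothing prevents `lamMax` from
being negative. -/
lemma spikedEigenvalue_le (σ : ℝ) {lam : Fin k → ℝ} {lamMax : ℝ} (hlam : ∀ i, lam i ≤ lamMax)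
    (i : Fin k ⊕ Fin n) : spikedEigenvalue σ lam n i ≤ σ ^ 2 + max lamMax 0 := by
  rcases i with i | i <;> simp [spikedEigenvalue, hlam]

namespace IsSpikedModel

variable {P : Measure Ω} {a b σ lamMax : ℝ} {U : Matrix (Fin d) (Fin k) ℝ} {lam : Fin k → ℝ}
    {ε x : Ω → EuclideanSpace ℝ (Fin d)} {t : Ω → ℝ}

lemma ae_map_time_mem (h : IsSpikedModel P a b σ lamMax U lam ε x t) :
    ∀ᵐ τ ∂(P.map t), τ ∈ Set.Icc a b := by
  rw [h.time_law]
  exact ae_cond_mem measurableSet_Icc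

lemma ae_time_mem (h : IsSpikedModel P a b σ lamMax U lam ε x t) :
    ∀ᵐ ω ∂P, t ω ∈ Set.Icc a b :=
  ae_of_ae_map h.measurable_time.aemeasurable h.ae_map_time_mem

lemma measurable_pair (h : IsSpikedModel P a b σ lamMax U lam ε x t) :
    Measurable fun ω => (ε ω, x ω) :=
  h.measurable_noise.prodMk h.measurable_data

lemma measurable_interpolant (h : IsSpikedModel P a b σ lamMax U lam ε x t) :
    Measurable (interpolant ε x t) :=
  ((measurable_const.sub h.measurable_time).smul h.measurable_noise).add
    (h.measurable_time.smul h.measurable_data)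

lemma memLp_noise (h : IsSpikedModel P a b σ lamMax U lam ε x t) : MemLp ε 2 P := by
  have g : IsGaussian (P.map ε) := by rw [h.noise_law]; infer_instance
  exact HasGaussianLaw.memLp ⟨g⟩ (by simp)

lemma memLp_data (h : IsSpikedModel P a b σ lamMax U lam ε x t) : MemLp x 2 P := by
  have g : IsGaussian (P.map x) := by rw [h.data_law]; infer_instance
  exact HasGaussianLaw.memLp ⟨g⟩ (by simp)

lemma memLp_velocity (h : IsSpikedModel P a b σ lamMax U lam ε x t) :
    MemLp (velocity ε x) 2 P :=
  h.memLp_data.sub h.memLp_noise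

lemma memLp_interpolant (h : IsSpikedModel P a b σ lamMax U lam ε x t) (ha : 0 < a)
    (hb : b < 1) : MemLp (interpolant ε x t) 2 P := by
  refine (h.memLp_noise.norm.add h.memLp_data.norm).mono
    h.measurable_interpolant.aestronglyMeasurable ?_
  filter_upwards [h.ae_time_mem] with ω hω
  have h0 : 0 ≤ t ω := ha.le.trans hω.1
  have h1 : t ω ≤ 1 := hω.2.trans hb.le
  simp only [Pi.add_apply]
  rw [Real.norm_of_nonneg (by positivity)]
  refine (norm_add_le _ _).trans ?_
  rw [norm_smul, norm_smul, Real.norm_of_nonneg h0, Real.norm_of_nonneg (by linarith)]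
  exact add_le_add (mul_le_of_le_one_left (norm_nonneg _) (by linarith))
    (mul_le_of_le_one_left (norm_nonneg _) h1)

/-- A general θ is allowed because both the true time and its estimate are substituted. -/
lemma memLp_drift (h : IsSpikedModel P a b σ lamMax U lam ε x t) (ha : 0 < a) (hb : b < 1)
    (hσ : 0 < σ) (B : OrthonormalBasis (Fin k ⊕ Fin n) ℝ (EuclideanSpace ℝ (Fin d)))
    {θ : Ω → ℝ} (hθ : Measurable θ) (hmem : ∀ᵐ ω ∂P, θ ω ∈ Set.Icc a b) :
    MemLp (fun ω => drift B (spikedEigenvalue σ lam n) (interpolant ε x t ω) (θ ω)) 2 P := by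
  have hb' : 0 < 1 - b := by linarith
  refine MemLp.of_le_mul (c := ((σ ^ 2 + max lamMax 0) + 1) / (1 - b) ^ 2)
    (h.memLp_interpolant ha hb)
    ((measurable_drift B _).comp (h.measurable_interpolant.prodMk hθ)).aestronglyMeasurable ?_
  filter_upwards [hmem] with ω hω
  refine norm_drift_le B _ (fun i => ?_) (by positivity) _
  exact abs_driftCoeff_le ((pow_pos hσ 2).trans_le (sq_le_spikedEigenvalue σ h.lam_nonneg i))
    (spikedEigenvalue_le σ h.lam_le i) hb (ha.le.trans hω.1) hω.2

variable {B : OrthonormalBasis (Fin k ⊕ Fin n) ℝ (EuclideanSpace ℝ (Fin d))}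

lemma resid_eq_inner (ω : Ω) (s : Fin k ⊕ Fin n → ℝ) (i : Fin k ⊕ Fin n) :
    residCoord (noiseCoord B) (dataCoord B) s (t ω) i (ε ω, x ω) =
      ⟪B i, velocity ε x ω - drift B s (interpolant ε x t ω) (t ω)⟫_ℝ := by
  have := velocity_sub_drift B s (ε ω, x ω) (t ω)
  change velocity ε x ω - drift B s (interpolant ε x t ω) (t ω) = _ at this
  rw [this, inner_sum]
  simp [inner_smul_right, B.inner_eq_ite]

lemma measurable_resid (s : Fin k ⊕ Fin n → ℝ) (i : Fin k ⊕ Fin n) :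
    Measurable fun q : (EuclideanSpace ℝ (Fin d) × EuclideanSpace ℝ (Fin d)) × ℝ =>
      residCoord (noiseCoord B) (dataCoord B) s q.2 i q.1 := by
  unfold residCoord interpCoord noiseCoord dataCoord
  have h1 : Measurable fun q : (EuclideanSpace ℝ (Fin d) × EuclideanSpace ℝ (Fin d)) × ℝ =>
      driftCoeff (s i) q.2 := (measurable_driftCoeff (s i)).comp measurable_snd
  fun_prop

lemma sigmaZT_le (h : IsSpikedModel P a b σ lamMax U lam ε x t) : sigmaZT ε x t ≤ m₀ :=
  (h.measurable_interpolant.prodMk h.measurable_time).comap_le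

lemma sigmaZ_le (h : IsSpikedModel P a b σ lamMax U lam ε x t) : sigmaZ ε x t ≤ m₀ :=
  h.measurable_interpolant.comap_le

variable [IsProbabilityMeasure P]

/-- The regression residual is centred on every event of the interpolant and the time. -/
lemma setIntegral_resid (h : IsSpikedModel P a b σ lamMax U lam ε x t) (ha : 0 < a) (hb : b < 1)
    (hσ : 0 < σ) (hB : ∀ i, B (Sum.inl i) = WithLp.toLp 2 (U.col i)) {A : Set Ω}
    (hA : MeasurableSet[sigmaZT ε x t] A) (i : Fin k ⊕ Fin n) :
    ∫ ω in A, residCoord (noiseCoord B) (dataCoord B) (spikedEigenvalue σ lam n) (t ω) i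
      (ε ω, x ω) ∂P = 0 := by
  have hs : ∀ i, 0 < spikedEigenvalue σ lam n i := fun i =>
    (pow_pos hσ 2).trans_le (sq_le_spikedEigenvalue σ h.lam_nonneg i)
  set s := spikedEigenvalue σ lam n with hsdef
  obtain ⟨A', hA', rfl⟩ := hA
  have hX := h.measurable_pair
  have hT := h.measurable_time
  have hres : Integrable (fun ω =>
      residCoord (noiseCoord B) (dataCoord B) s (t ω) i (ε ω, x ω)) P := by
    simp_rw [resid_eq_inner]
    refine Integrable.const_inner _ (MemLp.integrable (q := 2) (by norm_num) ?_)
    exact h.memLp_velocity.sub (h.memLp_drift ha hb hσ B hT h.ae_time_mem)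
  have hmeas := h.measurable_interpolant.prodMk hT
  let F : (EuclideanSpace ℝ (Fin d) × EuclideanSpace ℝ (Fin d)) × ℝ → ℝ := fun q =>
    A'.indicator (fun _ => (1 : ℝ)) ((1 - q.2) • q.1.1 + q.2 • q.1.2, q.2) *
      residCoord (noiseCoord B) (dataCoord B) s q.2 i q.1
  have hF : Measurable F :=
    ((measurable_const.indicator hA').comp (by fun_prop)).mul (measurable_resid s i)
  have hFeq : ∀ ω, F ((ε ω, x ω), t ω) =
      ((fun ω => (interpolant ε x t ω, t ω)) ⁻¹' A').indicator (fun ω =>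
        residCoord (noiseCoord B) (dataCoord B) s (t ω) i (ε ω, x ω)) ω := by
    intro ω
    by_cases hω : (interpolant ε x t ω, t ω) ∈ A'
    · rw [Set.indicator_of_mem (by exact hω)]
      change A'.indicator (fun _ => (1 : ℝ)) (interpolant ε x t ω, t ω) * _ = _
      rw [Set.indicator_of_mem hω, one_mul]
    · rw [Set.indicator_of_notMem (by exact hω)]
      change A'.indicator (fun _ => (1 : ℝ)) (interpolant ε x t ω, t ω) * _ = _
      rw [Set.indicator_of_notMem hω, zero_mul]
  rw [← integral_indicator (hmeas hA')]
  simp_rw [← hFeq]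
  rw [integral_indep hX hT h.indep_time hF
    (by simp_rw [hFeq]; exact hres.indicator (hmeas hA'))]
  refine integral_eq_zero_of_ae (Filter.Eventually.of_forall fun τ => ?_)
  have hG := h.isGaussianCoords hB
  -- With the time frozen, the event depends on the interpolant coordinates alone, which are
  -- independent of the centred residual.
  have hind : IndepFun
      (fun ω => A'.indicator (fun _ => (1 : ℝ)) ((1 - τ) • ε ω + τ • x ω, τ))
      (fun ω => residCoord (noiseCoord B) (dataCoord B) s τ i (ε ω, x ω)) P := by
    have hψ : Measurable fun c : Fin k ⊕ Fin n → ℝ => c i := measurable_pi_apply i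
    have hφ : Measurable fun c : Fin k ⊕ Fin n → ℝ =>
        A'.indicator (fun _ => (1 : ℝ)) (∑ i, c i • B i, τ) :=
      (measurable_const.indicator hA').comp (by fun_prop)
    have h1 := (hG.indepFun_interp_resid hs τ).comp hφ hψ
    convert! h1 using 1
    funext ω
    simp only [Function.comp_apply]
    congr 2
    rw [← B.sum_repr' ((1 - τ) • ε ω + τ • x ω)]
    exact Finset.sum_congr rfl fun j _ => by rw [inner_interp B (ε ω, x ω)]; rfl
  have hmul := hind.integral_mul_eq_mul_integral
    (((measurable_const.indicator hA').comp (by fun_prop :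
      Measurable fun p : EuclideanSpace ℝ (Fin d) × EuclideanSpace ℝ (Fin d) =>
        ((1 - τ) • p.1 + τ • p.2, τ))).comp hX).aestronglyMeasurable
    (((measurable_resid s i).comp (by fun_prop :
      Measurable fun p : EuclideanSpace ℝ (Fin d) × EuclideanSpace ℝ (Fin d) =>
        (p, τ))).comp hX).aestronglyMeasurable
  have hz : ∫ ω, residCoord (noiseCoord B) (dataCoord B) s τ i (ε ω, x ω) ∂P = 0 :=
    hG.integral_resid τ (hs i)
  rw [hz, mul_zero] at hmul
  exact hmul

lemma condExp_velocity (h : IsSpikedModel P a b σ lamMax U lam ε x t) (ha : 0 < a) (hb : b < 1)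
    (hσ : 0 < σ) (hB : ∀ i, B (Sum.inl i) = WithLp.toLp 2 (U.col i)) :
    P[velocity ε x | sigmaZT ε x t] =ᵐ[P]
      fun ω => drift B (spikedEigenvalue σ lam n) (interpolant ε x t ω) (t ω) := by
  have hd := h.memLp_drift ha hb hσ B h.measurable_time h.ae_time_mem
  have hdi := hd.integrable (by norm_num)
  have hvi := h.memLp_velocity.integrable (by norm_num)
  refine (ae_eq_condExp_of_forall_setIntegral_eq h.sigmaZT_le hvi
    (fun _ _ _ => hdi.integrableOn) (fun A hA _ => ?_) ?_).symm
  · rw [eq_comm, ← sub_eq_zero, ← integral_sub hvi.integrableOn hdi.integrableOn]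
    have heq : ∀ ω, velocity ε x ω -
        drift B (spikedEigenvalue σ lam n) (interpolant ε x t ω) (t ω) =
        ∑ i, residCoord (noiseCoord B) (dataCoord B) (spikedEigenvalue σ lam n) (t ω) i
          (ε ω, x ω) • B i := fun ω =>
      velocity_sub_drift B _ (ε ω, x ω) (t ω)
    simp_rw [heq]
    rw [integral_finsetSum]
    · refine Finset.sum_eq_zero fun i _ => ?_
      rw [integral_smul_const, h.setIntegral_resid ha hb hσ hB hA i, zero_smul]
    · intro i _
      refine Integrable.smul_const ?_ _
      simp_rw [resid_eq_inner]
      exact (Integrable.const_inner _ (hvi.sub hdi)).integrableOn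
  · have hzt : Measurable[sigmaZT ε x t] fun ω => (interpolant ε x t ω, t ω) :=
      Measurable.of_comap_le le_rfl
    have hm : StronglyMeasurable fun q : EuclideanSpace ℝ (Fin d) × ℝ =>
        drift B (spikedEigenvalue σ lam n) q.1 q.2 := (measurable_drift B _).stronglyMeasurable
    exact (hm.comp_measurable hzt).aestronglyMeasurable

/-- Each of the k + n directions contributes s / `interpVar s τ` ≥ s/(1 + s) ≥ σ²/(1 + σ²), whatever
the time. -/
lemma le_couplingVariance (h : IsSpikedModel P a b σ lamMax U lam ε x t) (ha : 0 < a)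
    (hb : b < 1) (hσ : 0 < σ) (hB : ∀ i, B (Sum.inl i) = WithLp.toLp 2 (U.col i)) :
    σ ^ 2 / (1 + σ ^ 2) * (k + n) ≤ couplingVariance P ε x t := by
  have hs : ∀ i, 0 < spikedEigenvalue σ lam n i := fun i =>
    (pow_pos hσ 2).trans_le (sq_le_spikedEigenvalue σ h.lam_nonneg i)
  have hs' : ∀ i, σ ^ 2 ≤ spikedEigenvalue σ lam n i := sq_le_spikedEigenvalue σ h.lam_nonneg
  set s := spikedEigenvalue σ lam n with hsdef
  have hG := h.isGaussianCoords hB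
  have hprob := Measure.isProbabilityMeasure_map h.measurable_time.aemeasurable (μ := P)
  have hd := h.memLp_drift ha hb hσ B h.measurable_time h.ae_time_mem
  have hw := h.memLp_velocity.sub hd
  have hC : couplingVariance P ε x t =
      ∫ ω, ‖velocity ε x ω - drift B s (interpolant ε x t ω) (t ω)‖ ^ 2 ∂P := by
    unfold couplingVariance vecCondVar
    rw [integral_condExp h.sigmaZT_le]
    refine integral_congr_ae ?_
    filter_upwards [h.condExp_velocity ha hb hσ hB] with ω hω
    rw [hω]
  have hnn : 0 ≤ couplingVariance P ε x t := by
    rw [hC]; exact integral_nonneg fun ω => by positivity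
  have hint : Integrable (fun ω =>
      ‖velocity ε x ω - drift B s (interpolant ε x t ω) (t ω)‖ ^ 2) P :=
    hw.integrable_norm_pow (p := 2) (by norm_num)
  rw [← ENNReal.ofReal_le_ofReal_iff hnn, hC, ofReal_integral_eq_lintegral_ofReal
    hint (Filter.Eventually.of_forall fun ω => by positivity)]
  have heq : ∀ ω, ‖velocity ε x ω - drift B s (interpolant ε x t ω) (t ω)‖ ^ 2 =
      ∑ i, residCoord (noiseCoord B) (dataCoord B) s (t ω) i (ε ω, x ω) ^ 2 := fun ω => by
    rw [← norm_sq_sum_smul_basis B, ← velocity_sub_drift B s (ε ω, x ω) (t ω)]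
    rfl
  simp_rw [heq]
  rw [lintegral_indep h.measurable_pair h.measurable_time h.indep_time
    (F := fun q => ENNReal.ofReal
      (∑ i, residCoord (noiseCoord B) (dataCoord B) s q.2 i q.1 ^ 2))
    (Finset.measurable_sum _ fun i _ => (measurable_resid s i).pow_const 2).ennreal_ofReal]
  have hconst : ENNReal.ofReal (σ ^ 2 / (1 + σ ^ 2) * (k + n)) =
      ∫⁻ _τ, ENNReal.ofReal (σ ^ 2 / (1 + σ ^ 2) * (k + n)) ∂(P.map t) := by simp
  rw [hconst]
  refine lintegral_mono_ae ?_
  filter_upwards [h.ae_map_time_mem] with τ hτ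
  have hi : ∀ i, Integrable
      (fun ω => residCoord (noiseCoord B) (dataCoord B) s τ i (ε ω, x ω) ^ 2) P := by
    intro i
    have h2 : MemLp (fun ω => residCoord (noiseCoord B) (dataCoord B) s τ i (ε ω, x ω)) 2 P :=
      ((hG.memLp_data i (by simp)).sub (hG.memLp_noise i (by simp))).sub
        ((hG.memLp_interp τ i (by simp)).const_mul _)
    exact h2.integrable_sq
  rw [← ofReal_integral_eq_lintegral_ofReal (integrable_finsetSum _ fun i _ => hi i)
    (Filter.Eventually.of_forall fun ω => by dsimp only; positivity),
    integral_finsetSum _ fun i _ => hi i]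
  refine ENNReal.ofReal_le_ofReal ?_
  have hval : ∀ i, ∫ ω, residCoord (noiseCoord B) (dataCoord B) s τ i (ε ω, x ω) ^ 2 ∂P =
      s i / interpVar (s i) τ := fun i => hG.integral_sq_resid τ (hs i)
  simp_rw [hval]
  have hlow : ∀ i, σ ^ 2 / (1 + σ ^ 2) ≤ s i / interpVar (s i) τ := by
    intro i
    have h1 := interpVar_le (hs i).le le_rfl (ha.le.trans hτ.1) (hτ.2.trans hb.le)
    rw [div_le_div_iff₀ (by positivity) (interpVar_pos (hs i) τ)]
    nlinarith [hs' i, mul_le_mul_of_nonneg_left h1 (sq_nonneg σ)]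
  calc σ ^ 2 / (1 + σ ^ 2) * (k + n) = ∑ _i : Fin k ⊕ Fin n, σ ^ 2 / (1 + σ ^ 2) := by
        simp; ring
    _ ≤ _ := Finset.sum_le_sum fun i _ => hlow i

/-- The competitor is `drift` at the time estimated from the isotropic mean square, a function of
`z` alone. -/
lemma timeBlindnessGap_le (h : IsSpikedModel P a b σ lamMax U lam ε x t) (ha : 0 < a)
    (hb : b < 1) (hσ : 0 < σ) (hB : ∀ i, B (Sum.inl i) = WithLp.toLp 2 (U.col i)) (hn : 0 < n)
    {κ L V : ℝ} {T : ℝ → ℝ} (hκ : 0 ≤ κ) (hT : Measurable T)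
    (hTmem : ∀ r, T r ∈ Set.Icc a b)
    (hTκ : ∀ τ ∈ Set.Icc a b, ∀ r, |T r - τ| ≤ κ * |r - interpVar (σ ^ 2) τ|)
    (hV : 1 + (σ ^ 2 + max lamMax 0) ≤ V)
    (hL : (3 * ((σ ^ 2 + max lamMax 0) + 1) + ((σ ^ 2 + max lamMax 0) + 1) ^ 2 + 2) /
      (1 - b) ^ 4 ≤ L) :
    timeBlindnessGap P ε x t ≤
      V ^ 2 * gaussFourth / n * (L ^ 2 * (n * (κ ^ 2 * V + κ)) + L ^ 2 * κ ^ 2 * (k * V)) := by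
  have hs : ∀ i, 0 < spikedEigenvalue σ lam n i := fun i =>
    (pow_pos hσ 2).trans_le (sq_le_spikedEigenvalue σ h.lam_nonneg i)
  have hS : ∀ i, spikedEigenvalue σ lam n i ≤ σ ^ 2 + max lamMax 0 := spikedEigenvalue_le σ h.lam_le
  have hinr : ∀ j : Fin n, spikedEigenvalue σ lam n (Sum.inr j) = σ ^ 2 := fun j => rfl
  set s := spikedEigenvalue σ lam n with hsdef
  have : Nonempty (Fin n) := ⟨⟨0, hn⟩⟩
  have hn' : (0 : ℝ) < n := by exact_mod_cast hn
  have hV0 : 0 ≤ V := le_trans (by positivity) hV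
  have hG := h.isGaussianCoords hB
  have hprob := Measure.isProbabilityMeasure_map h.measurable_time.aemeasurable (μ := P)
  have hR : Measurable fun z : EuclideanSpace ℝ (Fin d) => T (meanSq fun i => ⟪B i, z⟫_ℝ) :=
    hT.comp (by unfold meanSq; fun_prop)
  have hd := h.memLp_drift ha hb hσ B h.measurable_time h.ae_time_mem
  have hd' := h.memLp_drift ha hb hσ B (hR.comp h.measurable_interpolant)
    (Filter.Eventually.of_forall fun ω => hTmem _)
  have hE := h.condExp_velocity ha hb hσ hB
  have hmeasZ : AEStronglyMeasurable[sigmaZ ε x t] (fun ω => drift B s (interpolant ε x t ω)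
      (((fun z => T (meanSq fun i => ⟪B i, z⟫_ℝ)) ∘ interpolant ε x t) ω)) P := by
    refine (Measurable.stronglyMeasurable ?_).aestronglyMeasurable
    exact ((measurable_drift B s).comp (measurable_id.prodMk hR)).comp
      (comap_measurable (interpolant ε x t))
  have h1 := integral_vecCondVar_le h.sigmaZ_le (h.memLp_velocity.condExp (by norm_num)) hd' hmeasZ
    (X := P[velocity ε x | sigmaZT ε x t])
  have hbound : 0 ≤ V ^ 2 * gaussFourth / n *
      (L ^ 2 * (n * (κ ^ 2 * V + κ)) + L ^ 2 * κ ^ 2 * (k * V)) := by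
    have := gaussFourth_nonneg
    positivity
  refine h1.trans ?_
  have h2 : ∫ ω, ‖(P[velocity ε x | sigmaZT ε x t]) ω - drift B s (interpolant ε x t ω)
      (((fun z => T (meanSq fun i => ⟪B i, z⟫_ℝ)) ∘ interpolant ε x t) ω)‖ ^ 2 ∂P =
      ∫ ω, ‖drift B s (interpolant ε x t ω) (t ω) - drift B s (interpolant ε x t ω)
      (((fun z => T (meanSq fun i => ⟪B i, z⟫_ℝ)) ∘ interpolant ε x t) ω)‖ ^ 2 ∂P := by
    refine integral_congr_ae ?_
    filter_upwards [hE] with ω hω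
    rw [hω]
  have hint : Integrable (fun ω => ‖drift B s (interpolant ε x t ω) (t ω) -
      drift B s (interpolant ε x t ω)
        (((fun z => T (meanSq fun i => ⟪B i, z⟫_ℝ)) ∘ interpolant ε x t) ω)‖ ^ 2) P :=
    (hd.sub hd').integrable_norm_pow (p := 2) (by norm_num)
  rw [h2, ← ENNReal.ofReal_le_ofReal_iff hbound, ofReal_integral_eq_lintegral_ofReal
    hint (Filter.Eventually.of_forall fun ω => by positivity)]
  let F : (EuclideanSpace ℝ (Fin d) × EuclideanSpace ℝ (Fin d)) × ℝ → ENNReal := fun q =>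
    ENNReal.ofReal ((meanSq (fun i => interpCoord (noiseCoord B) (dataCoord B) q.2 i q.1) -
      interpVar (σ ^ 2) q.2) ^ 2 * (L ^ 2 * (n * (κ ^ 2 * V + κ)) + L ^ 2 * κ ^ 2 *
        ∑ i : Fin k, interpCoord (noiseCoord B) (dataCoord B) q.2 (Sum.inl i) q.1 ^ 2))
  have hF : Measurable F := by
    have hm : Measurable fun q : (EuclideanSpace ℝ (Fin d) × EuclideanSpace ℝ (Fin d)) × ℝ =>
      interpVar (σ ^ 2) q.2 := (measurable_interpVar _).comp measurable_snd
    refine Measurable.ennreal_ofReal ?_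
    unfold meanSq interpCoord noiseCoord dataCoord
    fun_prop
  calc _ ≤ ∫⁻ ω, F ((ε ω, x ω), t ω) ∂P := by
        refine lintegral_mono_ae ?_
        filter_upwards [h.ae_time_mem] with ω hω
        refine ENNReal.ofReal_le_ofReal ?_
        set R := meanSq fun i => ⟪B i, interpolant ε x t ω⟫_ℝ with hRdef
        have hmem := hTmem R
        have hδ : |t ω - T R| ≤ κ * |R - interpVar (σ ^ 2) (t ω)| := by
          rw [abs_sub_comm]; exact hTκ _ hω R
        -- Both times lie in [a, b], an interval of length below 1.
        have hδ1 : |t ω - T R| ≤ 1 := by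
          rw [abs_le]; constructor <;> linarith [hω.1, hω.2, hmem.1, hmem.2]
        have hdrift := norm_drift_sub_sq_le B s (L := L) (τ := t ω) (τ' := T R)
          (fun i => (abs_driftCoeff_sub_le (hs i) (hS i) hb (ha.le.trans hω.1) hω.2
            (ha.le.trans hmem.1) hmem.2).trans
              (mul_le_mul_of_nonneg_right hL (abs_nonneg _))) (interpolant ε x t ω)
        refine hdrift.trans ?_
        have hsplit : ∑ i, ⟪B i, interpolant ε x t ω⟫_ℝ ^ 2 =
            ∑ i : Fin k, ⟪B (Sum.inl i), interpolant ε x t ω⟫_ℝ ^ 2 + n * R := by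
          rw [Fintype.sum_sum_type, hRdef, meanSq, Fintype.card_fin]
          field_simp
        have hcoord : ∀ i, interpCoord (noiseCoord B) (dataCoord B) (t ω) i (ε ω, x ω) =
            ⟪B i, interpolant ε x t ω⟫_ℝ := fun i => (inner_interp B (ε ω, x ω) (t ω) i).symm
        have hvV : interpVar (σ ^ 2) (t ω) ≤ V :=
          (interpVar_le (sq_nonneg σ) (le_add_of_nonneg_right (le_max_right _ _))
            (ha.le.trans hω.1) (hω.2.trans hb.le)).trans hV
        have key := sq_estimator_mul_le hδ hδ1 hvV hV0 hn'.le
          (Finset.sum_nonneg (s := Finset.univ) fun (i : Fin k) _ =>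
            sq_nonneg (⟪B (Sum.inl i), interpolant ε x t ω⟫_ℝ))
        dsimp only
        simp_rw [hcoord]
        rw [hsplit]
        have := mul_le_mul_of_nonneg_left key (sq_nonneg L)
        rw [← hRdef]
        linarith
    _ = ∫⁻ τ, ∫⁻ ω, F ((ε ω, x ω), τ) ∂P ∂(P.map t) :=
        lintegral_indep h.measurable_pair h.measurable_time h.indep_time hF
    _ ≤ ∫⁻ _τ, ENNReal.ofReal (V ^ 2 * gaussFourth / n *
          (L ^ 2 * (n * (κ ^ 2 * V + κ)) + L ^ 2 * κ ^ 2 * (k * V))) ∂(P.map t) := by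
        refine lintegral_mono_ae ?_
        filter_upwards [h.ae_map_time_mem] with τ hτ
        have := hG.lintegral_meanSq_dev_le hs hinr τ
          (A := L ^ 2 * (n * (κ ^ 2 * V + κ))) (B := L ^ 2 * κ ^ 2) (V := V)
          (by positivity) (by positivity) (fun i =>
            (interpVar_le (hs i).le (hS i) (ha.le.trans hτ.1) (hτ.2.trans hb.le)).trans hV)
        rw [Fintype.card_fin, Fintype.card_fin] at this
        exact this
    _ = _ := by simp

end IsSpikedModel

/-- The gap ratio is bounded by a nonnegative constant over the codimension. -/
lemma exists_gap_ratio_bound {a b σ : ℝ} (lamMax : ℝ) (ha : 0 < a) (hab : a < b) (hb : b < 1)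
    (hσ : 0 < σ) (hI : 1 / (1 + σ ^ 2) ∉ Set.Icc a b) :
    ∃ C : ℝ, 0 ≤ C ∧ ∀ (d k : ℕ), k < d →
      ∀ {Ω : Type*} [MeasurableSpace Ω] (P : Measure Ω) [IsProbabilityMeasure P]
        (U : Matrix (Fin d) (Fin k) ℝ) (lam : Fin k → ℝ)
        (ε x : Ω → EuclideanSpace ℝ (Fin d)) (t : Ω → ℝ),
        IsSpikedModel P a b σ lamMax U lam ε x t →
          0 < couplingVariance P ε x t ∧
          timeBlindnessGap P ε x t / couplingVariance P ε x t ≤ C / ((d : ℝ) - (k : ℝ)) := by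
  obtain ⟨κ, T, hκ, hT, hTmem, hTκ⟩ := exists_time_estimator hab hI
  set V := 1 + (σ ^ 2 + max lamMax 0) with hV
  set L := (3 * ((σ ^ 2 + max lamMax 0) + 1) + ((σ ^ 2 + max lamMax 0) + 1) ^ 2 + 2) /
      (1 - b) ^ 4 with hL
  have hV0 : 0 < V := by positivity
  have hK := gaussFourth_nonneg
  set c := σ ^ 2 / (1 + σ ^ 2) with hc
  have hc0 : 0 < c := by positivity
  set D := V ^ 2 * gaussFourth * (L ^ 2 * (κ ^ 2 * V + κ)) with hD
  have hD0 : 0 ≤ D := by positivity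
  refine ⟨D / c, by positivity, ?_⟩
  intro d k hkd Ω _ P _ U lam ε x t h
  obtain ⟨B, hB⟩ := exists_orthonormalBasis_columns h.orthonormal hkd
  have hn : 0 < d - k := by omega
  have hlow := h.le_couplingVariance ha hb hσ hB
  have hup := h.timeBlindnessGap_le ha hb hσ hB hn hκ hT hTmem hTκ hV.ge hL.ge
  have hcast : ((d - k : ℕ) : ℝ) = (d : ℝ) - k := Nat.cast_sub hkd.le
  rw [hcast] at hlow hup
  have hn' : (0 : ℝ) < (d : ℝ) - k := by rw [← hcast]; exact_mod_cast hn
  have hd0 : (0 : ℝ) < d := by exact_mod_cast (by omega : 0 < d)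
  rw [← hc, add_sub_cancel] at hlow
  have hpos : 0 < couplingVariance P ε x t := lt_of_lt_of_le (by positivity) hlow
  refine ⟨hpos, ?_⟩
  rw [div_le_iff₀ hpos]
  have hup' : timeBlindnessGap P ε x t ≤ D * d / ((d : ℝ) - k) := by
    refine hup.trans ?_
    rw [div_mul_eq_mul_div]
    refine div_le_div_of_nonneg_right ?_ hn'.le
    -- Since κ²V ≤ κ²V + κ, the spike term is absorbed and (d - k) + k adds up to d.
    have hstep : L ^ 2 * (((d : ℝ) - k) * (κ ^ 2 * V + κ)) + L ^ 2 * κ ^ 2 * (k * V) ≤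
        L ^ 2 * (κ ^ 2 * V + κ) * d := by
      have : 0 ≤ L ^ 2 * κ * k := by positivity
      linarith
    calc _ ≤ V ^ 2 * gaussFourth * (L ^ 2 * (κ ^ 2 * V + κ) * d) :=
          mul_le_mul_of_nonneg_left hstep (by positivity)
      _ = D * d := by rw [hD]; ring
  refine hup'.trans ?_
  calc D * d / ((d : ℝ) - k) = D / c / ((d : ℝ) - k) * (c * d) := by field_simp
    _ ≤ _ := mul_le_mul_of_nonneg_left hlow (by positivity)

end Model

end FlowMatching

end

theorem theorem2 (a b σ lamMax : ℝ) (ha : 0 < a) (hab : a < b) (hb : b < 1) (hσ : 0 < σ)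
    (hI : 1 / (1 + σ ^ 2) ∉ Set.Icc a b) :
    (∃ C : ℝ, ∀ (d k : ℕ), k < d →
      ∀ {Ω : Type*} [MeasurableSpace Ω] (P : Measure Ω) [IsProbabilityMeasure P]
        (U : Matrix (Fin d) (Fin k) ℝ) (lam : Fin k → ℝ)
        (ε x : Ω → EuclideanSpace ℝ (Fin d)) (t : Ω → ℝ),
        FlowMatching.IsSpikedModel P a b σ lamMax U lam ε x t →
          0 < FlowMatching.couplingVariance P ε x t ∧
          FlowMatching.timeBlindnessGap P ε x t / FlowMatching.couplingVariance P ε x t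
            ≤ C / ((d : ℝ) - (k : ℝ))) ∧
    (∀ k : ℕ, ∃ C : ℝ, ∀ d : ℕ, k < d →
      ∀ {Ω : Type*} [MeasurableSpace Ω] (P : Measure Ω) [IsProbabilityMeasure P]
        (U : Matrix (Fin d) (Fin k) ℝ) (lam : Fin k → ℝ)
        (ε x : Ω → EuclideanSpace ℝ (Fin d)) (t : Ω → ℝ),
        FlowMatching.IsSpikedModel P a b σ lamMax U lam ε x t →
          FlowMatching.timeBlindnessGap P ε x t / FlowMatching.couplingVariance P ε x t
            ≤ C / (d : ℝ)) := by
  refine ⟨?_, fun k => ?_⟩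
  · obtain ⟨C, -, hmain⟩ := FlowMatching.exists_gap_ratio_bound lamMax ha hab hb hσ hI
    exact ⟨C, hmain⟩
  obtain ⟨C, hC, hmain⟩ := FlowMatching.exists_gap_ratio_bound lamMax ha hab hb hσ hI
  -- From d ≥ k + 1 follows d ≤ (k + 1)(d - k); scaling this by C needs C ≥ 0.
  refine ⟨C * (k + 1), ?_⟩
  intro d hkd Ω _ P _ U lam ε x t h
  refine (hmain d k hkd P U lam ε x t h).2.trans ?_
  have h1 : (k : ℝ) + 1 ≤ d := by exact_mod_cast hkd
  have h2 : (0 : ℝ) ≤ k := by positivity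
  rw [div_le_div_iff₀ (by linarith) (by linarith), mul_assoc]
  refine mul_le_mul_of_nonneg_left ?_ hC
  nlinarith
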